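/- **Conventions.** Composition in fundamental groups and groupoids is written in diagrammatic order ($uv$ is "first $u$, then $v$"). For a set $A\subseteq Y$ of base points, $\pi_1(Y,A)$ is the full subgroupoid of the fundamental groupoid of $Y$ on the points of $A$, and $H_1(Y,A)$ is relative (normalised cubical) singular homology with integer coefficients. For a groupoid $C$, $\upsilon\colon C\to C^{\rm totab}$ is the universal morphism from $C$ to an abelian group. For a homomorphism of groups $\phi\colon F\to G$, $\widehat F$ is the groupoid with object set $G$, with morphisms the pairs $(u,g)\colon(\phi u)g\to g$ ($u\in F$, $g\in G$) and composition $(u,(\phi v)g)(v,g)=(uv,g)$; the group $G$ operates on the right of $\widehat F$ by $(u,g)^k=(u,gk)$, so that $\widehat F^{\rm totab}$ is a right $G$-module. A *$\phi$-derivation* into a right $G$-module $M$ is a function $d\colon F\to M$ with $d(uv)=d(u)^{\phi v}+d(v)$; a $\phi$-derivation $\partial\colon F\to D$ is *universal* if for every $\phi$-derivation $d\colon F\to M$ there is a unique $G$-morphism $d'\colon D\to M$ with $d'\partial=d$. **Theorem.** Let $p\colon\widehat X\to X$ be a covering map of path-connected spaces, let $x\in X$, let $N$ be a normal subgroup of $F=\pi_1(X,x)$,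 let $\phi\colon F\to G=F/N$ be the quotient morphism, and let $\widetilde X_0=p^{-1}(x)$. Suppose that $p$ is determined by $N$, i.e. $p_*\pi_1(\widehat X,\hat x)=N$ where $\hat x\in\widetilde X_0$. Then: 1. There is an isomorphism of groupoids $T\colon\widehat F\to\pi_1(\widehat X,\widetilde X_0)$ which on objects is a bijection $G\to\widetilde X_0$ with $1\mapsto\hat x$, and which is compatible with the projections to $F$: $p_*(T(u,g))=u$. 2. There is an isomorphism of abelian groups $\Psi\colon\widehat F^{\rm totab}\to H_1(\widehat X,\widetilde X_0)$ induced by $T$: for every morphism $m$ of $\widehat F$, $\Psi(\upsilon(m))$ is the homology class of any path in $\widehat X$ representing $T(m)$. 3. There is a right $G$-module structure on $H_1(\widehat X,\widetilde X_0)$ for which $\Psi$ is an isomorphism of $G$-modules; for it, if $h\colon\widehat X\to\widehat X$ is a covering transformation (a homeomorphism with $ph=p$) and $h(\hat x)=T(k)$ with $k\in G$, then $k$ acts on $H_1(\widehat X,\widetilde X_0)$ as $h_*$. With this structure there is a universal $\phi$-derivation $\partial\colon\pi_1(X,x)\to H_1(\widehat X,\widetilde X_0)$, namely the function such that $\partial(u)$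 is the homology class of any path in $\widehat X$ which ends at $\hat x$ and projects to a loop in the class $u$. -/

import Mathlib

open CategoryTheory MulOpposite

noncomputable section

/-! ### The fundamental group and the fundamental groupoid on a set of base points

Composition of path classes is written in diagrammatic order throughout: `u * v` is
"first `u`, then `v`". -/

/-- `π₁(X, x)`, the vertex group at `x` of the fundamental groupoid of `X`, with
multiplication `u * v = u ≫ v` (first `u`, then `v`). -/
abbrev PiOne {X : Type*} [TopologicalSpace X] (x : X) : Type _ :=
  FundamentalGroupoid.mk x ⟶ FundamentalGroupoid.mk x

/-- The objects of `π₁(X, A)`: the points of `A`. -/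
@[ext]
structure PiOneOn {X : Type*} (A : Set X) where
  pt : X
  mem : pt ∈ A

/-- `π₁(X, A)`, the fundamental groupoid of `X` on the set `A` of base points: the full
subgroupoid of the fundamental groupoid of `X` on the points of `A`. -/
instance {X : Type*} [TopologicalSpace X] (A : Set X) : Groupoid (PiOneOn A) where
  Hom a b := FundamentalGroupoid.mk a.pt ⟶ FundamentalGroupoid.mk b.pt
  id a := 𝟙 (FundamentalGroupoid.mk a.pt)
  comp f g := CategoryStruct.comp (obj := FundamentalGroupoid X) f g
  id_comp f := Category.id_comp (obj := FundamentalGroupoid X) f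
  comp_id f := Category.comp_id (obj := FundamentalGroupoid X) f
  assoc f g h := Category.assoc (obj := FundamentalGroupoid X) f g h
  inv f := Groupoid.inv (obj := FundamentalGroupoid X) f
  inv_comp f := Groupoid.inv_comp (obj := FundamentalGroupoid X) f
  comp_inv f := Groupoid.comp_inv (obj := FundamentalGroupoid X) f

/-- The morphism of `π₁(X, A)` represented by a path between two points of `A`. -/
def PiOneOn.homMk {X : Type*} [TopologicalSpace X] {A : Set X} {a b : PiOneOn A}
    (γ : Path a.pt b.pt) : a ⟶ b :=
  (Path.Homotopic.Quotient.mk γ : Path.Homotopic.Quotient a.pt b.pt)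

section Fibre

variable {E X : Type*} [TopologicalSpace E] [TopologicalSpace X] (p : C(E, X)) (x : X)

/-- For `p : E → X`, the map `π₁(E, p⁻¹(x)) → π₁(X, x)` induced by `p`. -/
def fibreProj {a b : PiOneOn (p ⁻¹' {x})} (γ : a ⟶ b) : PiOne x :=
  (Path.Homotopic.Quotient.map (show Path.Homotopic.Quotient a.pt b.pt from γ) p).cast
    (Eq.symm a.mem) (Eq.symm b.mem)

theorem fibreProj_id (a : PiOneOn (p ⁻¹' {x})) : fibreProj p x (𝟙 a) = 1 := by
  obtain ⟨a, rfl⟩ := a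
  rfl

theorem fibreProj_comp {a b c : PiOneOn (p ⁻¹' {x})} (γ : a ⟶ b) (δ : b ⟶ c) :
    fibreProj p x (γ ≫ δ) = fibreProj p x γ * fibreProj p x δ := by
  obtain ⟨a, rfl⟩ := a
  obtain ⟨b, hb⟩ := b
  obtain ⟨c, hc⟩ := c
  induction γ using Path.Homotopic.Quotient.ind with | mk γ =>
  induction δ using Path.Homotopic.Quotient.ind with | mk δ =>
  change Path.Homotopic.Quotient.mk _ = Path.Homotopic.Quotient.mk (Path.trans _ _)
  congr 1
  ext t
  simp only [Path.cast_coe, Path.map_coe, Function.comp_apply, Path.trans_apply]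
  split_ifs <;> rfl

/-- The homomorphism `p_* : π₁(E, e) → π₁(X, x)`, for a point `e` of `E` over `x`. -/
def fibrePush (e : PiOneOn (p ⁻¹' {x})) : PiOne e.pt →* PiOne x where
  toFun γ := fibreProj p x (show e ⟶ e from γ)
  map_one' := fibreProj_id p x e
  map_mul' γ δ := fibreProj_comp p x (show e ⟶ e from γ) (show e ⟶ e from δ)

end Fibre

/-! ### The covering groupoid `F̂` of a homomorphism `φ : F → G` -/

/-- The objects of the groupoid `F̂` of `φ : F →* G`: the elements of `G`. -/
@[ext]
structure HatGroupoid {F G : Type*} [Group F] [Group G] (φ : F →* G) where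
  el : G

namespace HatGroupoid

variable {F G : Type*} [Group F] [Group G] {φ : F →* G}

/-- A morphism `g' ⟶ g` of `F̂` is a pair `(u, g)` with `u ∈ F` and `g' = (φ u) g`. -/
@[ext]
structure Hom (a b : HatGroupoid φ) where
  arr : F
  src : φ arr * b.el = a.el

/-- The groupoid `F̂`, i.e. the pullback along `φ : F → G` of the universal covering groupoid
`G̃ → G`: its composition is `(u, (φ v) g) (v, g) = (u v, g)`. -/
instance : Groupoid (HatGroupoid φ) where
  Hom := Hom
  id a := ⟨1, by simp⟩
  comp f g := ⟨f.arr * g.arr, by rw [map_mul, mul_assoc, g.src, f.src]⟩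
  id_comp f := Hom.ext (one_mul _)
  comp_id f := Hom.ext (mul_one _)
  assoc f g h := Hom.ext (mul_assoc _ _ _)
  inv f := ⟨f.arr⁻¹, by rw [← f.src]; simp⟩
  inv_comp f := Hom.ext (inv_mul_cancel _)
  comp_inv f := Hom.ext (mul_inv_cancel _)

/-- The covering morphism `q : F̂ → F`, `(u, g) ↦ u`. -/
def proj {a b : HatGroupoid φ} (f : a ⟶ b) : F := Hom.arr f

/-- The right operation of `k ∈ G` on `F̂`: `(u, g) ^ k = (u, g k)`. -/
def translate (k : G) : HatGroupoid φ ⥤ HatGroupoid φ where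
  obj a := ⟨a.el * k⟩
  map {_ b} f := (⟨Hom.arr f, by rw [← mul_assoc, Hom.src f]⟩ : Hom _ ⟨b.el * k⟩)

end HatGroupoid

/-! ### The universal abelianisation of a groupoid -/

/-- The relations `[f ≫ g] = [f] + [g]` between the arrows of a groupoid. -/
def totabRelations (C : Type*) [Groupoid C] :
    Set (FreeAbelianGroup (Σ a b : C, a ⟶ b)) :=
  {r | ∃ (a b c : C) (f : a ⟶ b) (g : b ⟶ c), r =
    FreeAbelianGroup.of ⟨a, c, f ≫ g⟩ -
      (FreeAbelianGroup.of ⟨a, b, f⟩ + FreeAbelianGroup.of ⟨b, c, g⟩)}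

/-- The universal abelianisation `C^totab` of a groupoid `C`: the abelian group generated by
the arrows of `C` subject to the relations `[f ≫ g] = [f] + [g]`. -/
def Totab (C : Type*) [Groupoid C] : Type _ :=
  FreeAbelianGroup (Σ a b : C, a ⟶ b) ⧸ AddSubgroup.closure (totabRelations C)

namespace Totab

variable {C D : Type*} [Groupoid C] [Groupoid D] {M : Type*} [AddCommGroup M]

instance : AddCommGroup (Totab C) :=
  inferInstanceAs (AddCommGroup (_ ⧸ AddSubgroup.closure (totabRelations C)))

/-- The universal morphism `υ : C → C^totab`. -/
def of {a b : C} (f : a ⟶ b) : Totab C :=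
  QuotientAddGroup.mk (FreeAbelianGroup.of ⟨a, b, f⟩)

theorem of_comp {a b c : C} (f : a ⟶ b) (g : b ⟶ c) : of (f ≫ g) = of f + of g := by
  have h : FreeAbelianGroup.of (⟨a, c, f ≫ g⟩ : Σ a b : C, a ⟶ b) -
      (FreeAbelianGroup.of ⟨a, b, f⟩ + FreeAbelianGroup.of ⟨b, c, g⟩) ∈
      AddSubgroup.closure (totabRelations C) :=
    AddSubgroup.subset_closure ⟨a, b, c, f, g, rfl⟩
  have h' := (QuotientAddGroup.eq_zero_iff _).mpr h
  exact sub_eq_zero.mp h'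

/-- The universal property of `C^totab`: existence. -/
def lift (F : ∀ {a b : C}, (a ⟶ b) → M)
    (hF : ∀ {a b c : C} (f : a ⟶ b) (g : b ⟶ c), F (f ≫ g) = F f + F g) : Totab C →+ M :=
  QuotientAddGroup.lift _ (FreeAbelianGroup.lift fun s => F s.2.2) <| by
    rw [AddSubgroup.closure_le]
    rintro _ ⟨a, b, c, f, g, rfl⟩
    simp [hF]

@[simp]
theorem lift_of (F : ∀ {a b : C}, (a ⟶ b) → M)
    (hF : ∀ {a b c : C} (f : a ⟶ b) (g : b ⟶ c), F (f ≫ g) = F f + F g)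
    {a b : C} (f : a ⟶ b) : lift F hF (of f) = F f :=
  FreeAbelianGroup.lift_apply_of (fun s : Σ a b : C, a ⟶ b => F s.2.2) ⟨a, b, f⟩

/-- The universal property of `C^totab`: uniqueness. -/
theorem hom_ext {α β : Totab C →+ M} (h : ∀ {a b : C} (f : a ⟶ b), α (of f) = β (of f)) :
    α = β :=
  QuotientAddGroup.addMonoidHom_ext _ (FreeAbelianGroup.lift_ext _ _ fun s => h s.2.2)

/-- The homomorphism `C^totab → D^totab` induced by a morphism of groupoids `C → D`. -/
def map (T : C ⥤ D) : Totab C →+ Totab D :=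
  lift (fun f => of (T.map f)) fun f g => by rw [T.map_comp, of_comp]

theorem of_congr {F G : Type*} [Group F] [Group G] {φ : F →* G} {a b a' b' : HatGroupoid φ}
    {f : a ⟶ b} {f' : a' ⟶ b'} (ha : a = a') (hb : b = b')
    (h : HatGroupoid.proj f = HatGroupoid.proj f') : of f = of f' := by
  subst ha hb
  exact congrArg of (HatGroupoid.Hom.ext h)

end Totab

/-- The right `G`-module structure on `F̂^totab` induced by the right operation of `G` on `F̂`.
A right action of `G` is an action of `Gᵐᵒᵖ`: `m ^ g` is `op g • m`. -/
instance {F G : Type*} [Group F] [Group G] (φ : F →* G) :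
    DistribMulAction Gᵐᵒᵖ (Totab (HatGroupoid φ)) where
  smul k m := Totab.map (HatGroupoid.translate k.unop) m
  one_smul m := by
    change Totab.map (HatGroupoid.translate 1) m = AddMonoidHom.id _ m
    congr 1
    refine Totab.hom_ext fun {a b} f => ?_
    simp only [Totab.map, AddMonoidHom.id_apply]
    exact Totab.of_congr (HatGroupoid.ext (mul_one _)) (HatGroupoid.ext (mul_one _)) rfl
  mul_smul k l m := by
    change Totab.map (HatGroupoid.translate (l.unop * k.unop)) m =
      ((Totab.map (HatGroupoid.translate k.unop)).comp
        (Totab.map (HatGroupoid.translate l.unop))) m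
    congr 1
    refine Totab.hom_ext fun {a b} f => ?_
    simp only [Totab.map, AddMonoidHom.comp_apply]
    exact Totab.of_congr (HatGroupoid.ext (mul_assoc _ _ _).symm)
      (HatGroupoid.ext (mul_assoc _ _ _).symm) rfl
  smul_zero k := map_zero _
  smul_add k m m' := map_add _ m m'

/-! ### Derivations -/

/-- `d : F → M` is a `φ`-derivation into the right `G`-module `M`:
`d (u v) = (d u) ^ (φ v) + d v`. -/
def IsDerivationOver {F G M : Type*} [Group F] [Group G] (φ : F →* G) [AddCommGroup M]
    [DistribMulAction Gᵐᵒᵖ M] (d : F → M) : Prop :=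
  ∀ u v : F, d (u * v) = op (φ v) • d u + d v

/-- `δ : F → D` is a universal `φ`-derivation: every `φ`-derivation `d : F → M` factors as
`d' ∘ δ` for a unique morphism of right `G`-modules `d' : D → M`. -/
def IsUniversalDerivation.{w, u₁, u₂, u₃} {F : Type u₁} {G : Type u₂} {D : Type u₃}
    [Group F] [Group G] (φ : F →* G) [AddCommGroup D] [DistribMulAction Gᵐᵒᵖ D]
    (δ : F → D) : Prop :=
  IsDerivationOver φ δ ∧
    ∀ (M : Type w) [AddCommGroup M] [DistribMulAction Gᵐᵒᵖ M] (d : F → M),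
      IsDerivationOver φ d → ∃! d' : D →+[Gᵐᵒᵖ] M, ∀ u : F, d' (δ u) = d u

/-! ### Relative (normalised) cubical singular homology -/

section Homology

variable {X Y : Type*} [TopologicalSpace X] [TopologicalSpace Y]

/-- The singular `n`-cubes of `X`. -/
abbrev SingCube (X : Type*) [TopologicalSpace X] (n : ℕ) : Type _ := C(Fin n → unitInterval, X)

/-- A singular cube is degenerate if it does not depend on one of its coordinates. -/
def SingCube.IsDegenerate {n : ℕ} (σ : SingCube X n) : Prop :=
  ∃ i : Fin n, ∀ s t : Fin n → unitInterval, (∀ j, j ≠ i → s j = t j) → σ s = σ t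

/-- The face of a singular cube on which the `i`-th coordinate equals `ε`. -/
def SingCube.face {n : ℕ} (i : Fin (n + 1)) (ε : unitInterval) (σ : SingCube X (n + 1)) : SingCube X n :=
  σ.comp ⟨fun t => i.insertNth (α := fun _ => unitInterval) ε t,
    continuous_const.finInsertNth i continuous_id⟩

/-- The boundary `∂ σ = ∑ᵢ (-1)ⁱ (∂ᵢ⁻ σ - ∂ᵢ⁺ σ)` on unnormalised cubical chains, the
coordinates being numbered from 1 in this formula. -/
def cubeBoundary (X : Type*) [TopologicalSpace X] (n : ℕ) :
    FreeAbelianGroup (SingCube X (n + 1)) →+ FreeAbelianGroup (SingCube X n) :=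
  FreeAbelianGroup.lift fun σ => ∑ i : Fin (n + 1), (-1 : ℤ) ^ (i.val + 1) •
    (FreeAbelianGroup.of (σ.face i 0) - FreeAbelianGroup.of (σ.face i 1))

/-- The chains that are zero in `C_n(X, A) = C_n(X) / C_n(A)`, where `C_n` denotes normalised
chains: the combinations of degenerate cubes and of cubes lying in `A`. -/
def nullChains (A : Set X) (n : ℕ) : AddSubgroup (FreeAbelianGroup (SingCube X n)) :=
  AddSubgroup.closure {c | ∃ σ : SingCube X n,
    (σ.IsDegenerate ∨ ∀ t, σ t ∈ A) ∧ c = FreeAbelianGroup.of σ}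

/-- The chains of `X` representing cycles of `C_*(X, A)`. -/
def relCycles (A : Set X) : ∀ n : ℕ, AddSubgroup (FreeAbelianGroup (SingCube X n))
  | 0 => ⊤
  | n + 1 => (nullChains A n).comap (cubeBoundary X n)

/-- The chains of `X` representing boundaries of `C_*(X, A)`. -/
def relBoundaries (A : Set X) (n : ℕ) : AddSubgroup (FreeAbelianGroup (SingCube X n)) :=
  (cubeBoundary X n).range ⊔ nullChains A n

/-- The relative singular homology group `H_n(X, A)` with integer coefficients. -/
def RelHomology (A : Set X) (n : ℕ) : Type _ :=
  relCycles A n ⧸ (relBoundaries A n).addSubgroupOf (relCycles A n)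

instance (A : Set X) (n : ℕ) : AddCommGroup (RelHomology A n) :=
  inferInstanceAs (AddCommGroup (_ ⧸ (relBoundaries A n).addSubgroupOf (relCycles A n)))

/-- The map of unnormalised cubical chains induced by a continuous map. -/
def cubeMap (f : C(X, Y)) (n : ℕ) :
    FreeAbelianGroup (SingCube X n) →+ FreeAbelianGroup (SingCube Y n) :=
  FreeAbelianGroup.map fun σ => f.comp σ

theorem cubeMap_boundary (f : C(X, Y)) (n : ℕ) (c : FreeAbelianGroup (SingCube X (n + 1))) :
    cubeBoundary Y n (cubeMap f (n + 1) c) = cubeMap f n (cubeBoundary X n c) := by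
  suffices h : (cubeBoundary Y n).comp (cubeMap f (n + 1)) =
      (cubeMap f n).comp (cubeBoundary X n) from DFunLike.congr_fun h c
  refine FreeAbelianGroup.lift_ext _ _ fun σ => ?_
  simp only [AddMonoidHom.comp_apply, cubeMap, cubeBoundary, FreeAbelianGroup.map_of_apply,
    FreeAbelianGroup.lift_apply_of, map_sum, map_zsmul, map_sub]
  rfl

theorem cubeMap_null {A : Set X} {B : Set Y} (f : C(X, Y)) (hf : Set.MapsTo f A B) (n : ℕ) :
    nullChains A n ≤ (nullChains B n).comap (cubeMap f n) := by
  rw [nullChains, AddSubgroup.closure_le]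
  rintro _ ⟨σ, hσ, rfl⟩
  refine AddSubgroup.subset_closure ⟨f.comp σ, ?_, FreeAbelianGroup.map_of_apply σ⟩
  rcases hσ with ⟨i, hi⟩ | hσ
  · exact Or.inl ⟨i, fun s t h => congrArg f (hi s t h)⟩
  · exact Or.inr fun t => hf (hσ t)

theorem cubeMap_cycles {A : Set X} {B : Set Y} (f : C(X, Y)) (hf : Set.MapsTo f A B) (n : ℕ) :
    relCycles A n ≤ (relCycles B n).comap (cubeMap f n) := by
  cases n with
  | zero => exact fun _ _ => AddSubgroup.mem_top _
  | succ n =>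
    intro c hc
    change cubeBoundary Y n (cubeMap f (n + 1) c) ∈ nullChains B n
    rw [cubeMap_boundary]
    exact cubeMap_null f hf n hc

theorem cubeMap_boundaries {A : Set X} {B : Set Y} (f : C(X, Y)) (hf : Set.MapsTo f A B)
    (n : ℕ) : relBoundaries A n ≤ (relBoundaries B n).comap (cubeMap f n) := by
  refine sup_le ?_ ?_
  · rintro _ ⟨c, rfl⟩
    exact AddSubgroup.mem_sup_left ⟨cubeMap f (n + 1) c, cubeMap_boundary f n c⟩
  · exact fun c hc => AddSubgroup.mem_sup_right (cubeMap_null f hf n hc)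

/-- The homomorphism `f_* : H_n(X, A) → H_n(Y, B)` induced by a map of pairs. -/
def RelHomology.map {A : Set X} {B : Set Y} (f : C(X, Y)) (hf : Set.MapsTo f A B) (n : ℕ) :
    RelHomology A n →+ RelHomology B n :=
  QuotientAddGroup.map _ _
    (((cubeMap f n).comp (relCycles A n).subtype).codRestrict (relCycles B n)
      fun c => cubeMap_cycles f hf n c.2)
    fun c hc => cubeMap_boundaries f hf n (x := c.1) hc

/-- A path regarded as a singular 1-cube. -/
def pathCube {a b : X} (γ : Path a b) : SingCube X 1 :=
  ⟨fun t => γ (t 0), γ.continuous.comp (continuous_apply 0)⟩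

theorem pathCube_mem_relCycles {A : Set X} {a b : PiOneOn A} (γ : Path a.pt b.pt) :
    FreeAbelianGroup.of (pathCube γ) ∈ relCycles A 1 := by
  change cubeBoundary X 0 _ ∈ nullChains A 0
  rw [cubeBoundary, FreeAbelianGroup.lift_apply_of, Fin.sum_univ_one]
  refine AddSubgroup.zsmul_mem _ (AddSubgroup.sub_mem _ ?_ ?_) _
  · refine AddSubgroup.subset_closure ⟨_, Or.inr fun t => ?_, rfl⟩
    change γ 0 ∈ A
    simpa using a.mem
  · refine AddSubgroup.subset_closure ⟨_, Or.inr fun t => ?_, rfl⟩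
    change γ 1 ∈ A
    simpa using b.mem

/-- The class in `H₁(X, A)` of a path in `X` whose end points lie in `A`. -/
def pathClass {A : Set X} {a b : PiOneOn A} (γ : Path a.pt b.pt) : RelHomology A 1 :=
  QuotientAddGroup.mk ⟨FreeAbelianGroup.of (pathCube γ), pathCube_mem_relCycles γ⟩

end Homology

end

universe w u v

/-! Both `F̂` and the fundamental groupoid on the fibre are coverings of the group `F`: a morphism
is determined by its target and its projection to `F`, and every element of `F` lifts to any given
target. To match their objects, give a point `e` of the fibre as coordinate the class mod `N` of the
projection of any path from `e` to `xhat`. Loops at `xhat` project exactly onto `N`, so this is well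
defined and injective; path lifting makes it surjective. Equations between morphisms with given ends
can then be checked in `F`.

Next, `totabToHomology_bijective`: for path-connected `Y` and a set `A` containing only constant
paths, the abelianised groupoid on `A` is `H₁(Y, A)`. Subdivision and homotopy of paths are
boundaries of squares, so paths have additive classes. For the inverse, a 1-cube is closed up by
chosen paths from `A` to its ends; squares go to zero because the two ways round a square are
homotopic. The added paths depend only on the ends and cancel on relative cycles. Fibres of a
covering satisfy the condition on `A`.

Finally, `u ↦ υ(u, 1)` is a universal derivation into `F̂^totab`, because `υ(u, g)` is its translate
by `g` and the composition law of `F̂` is the derivation rule. Module structure and derivation are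
transported to homology. A covering transformation keeps projections and multiplies coordinates on
the right by a fixed `k`, so it induces the action of `k`. -/

section CoveringGroupoid

/-! ### Lifting of path classes to the fibre -/

variable {E X : Type*} [TopologicalSpace E] [TopologicalSpace X] {p : C(E, X)} {x : X}

theorem PiOneOn.homMk_surjective {A : Set X} {a b : PiOneOn A} (f : a ⟶ b) :
    ∃ γ : Path a.pt b.pt, PiOneOn.homMk γ = f :=
  Path.Homotopic.Quotient.mk_surjective f

theorem PiOneOn.nonempty_hom [PathConnectedSpace X] {A : Set X} (a b : PiOneOn A) :
    Nonempty (a ⟶ b) :=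
  ⟨PiOneOn.homMk (PathConnectedSpace.somePath a.pt b.pt)⟩

theorem fibreProj_inv {a b : PiOneOn (p ⁻¹' {x})} (γ : a ⟶ b) :
    fibreProj p x (Groupoid.inv γ) = (fibreProj p x γ)⁻¹ := by
  rw [eq_inv_iff_mul_eq_one, ← fibreProj_comp, Groupoid.inv_comp, fibreProj_id]

theorem fibreProj_eqToHom {a b : PiOneOn (p ⁻¹' {x})} (h : a = b) :
    fibreProj p x (eqToHom h) = 1 := by
  subst h
  exact fibreProj_id p x a

theorem Path.Homotopic.Quotient.cast_symm_cast {a b a' b' : X}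
    (q : Path.Homotopic.Quotient a b) (ha : a' = a) (hb : b' = b) :
    (q.cast ha hb).cast ha.symm hb.symm = q := by
  subst ha hb
  rw [Path.Homotopic.Quotient.cast_rfl_rfl, Path.Homotopic.Quotient.cast_rfl_rfl]

/-- Homotopies lift: a covering map is injective on path classes with given ends. The casts that
move the ends to `x` are undone first. -/
theorem fibreProj_injective (hp : IsCoveringMap p) (a b : PiOneOn (p ⁻¹' {x})) :
    Function.Injective fun γ : a ⟶ b => fibreProj p x γ := by
  intro γ γ' h
  refine hp.injective_path_homotopic_map a.pt b.pt ?_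
  have h' := congrArg (fun q : Path.Homotopic.Quotient x x => q.cast a.mem b.mem) h
  exact ((Path.Homotopic.Quotient.cast_symm_cast _ (Eq.symm a.mem) (Eq.symm b.mem)).symm.trans
    h').trans (Path.Homotopic.Quotient.cast_symm_cast _ (Eq.symm a.mem) (Eq.symm b.mem))

theorem exists_fibreProj_eq_from (hp : IsCoveringMap p) (a : PiOneOn (p ⁻¹' {x})) (u : PiOne x) :
    ∃ (b : PiOneOn (p ⁻¹' {x})) (γ : a ⟶ b), fibreProj p x γ = u := by
  let e : p ⁻¹' {x} := ⟨a.pt, a.mem⟩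
  refine ⟨⟨hp.monodromy u e, (hp.monodromy u e).2⟩, hp.liftPathQuotient u e, ?_⟩
  have h := congrArg
    (fun q => Path.Homotopic.Quotient.cast q e.2.symm (hp.monodromy u e).2.symm)
    (hp.map_liftPathQuotient u e)
  exact h.trans (Path.Homotopic.Quotient.cast_symm_cast u e.2 (hp.monodromy u e).2)

/-- Paths lift from their starting point, whereas morphisms of `F̂` are indexed by their target;
hence the inverse is lifted and reversed. -/
theorem exists_fibreProj_eq (hp : IsCoveringMap p) (b : PiOneOn (p ⁻¹' {x})) (u : PiOne x) :
    ∃ (a : PiOneOn (p ⁻¹' {x})) (γ : a ⟶ b), fibreProj p x γ = u := by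
  obtain ⟨a, γ, h⟩ := exists_fibreProj_eq_from hp b u⁻¹
  exact ⟨a, Groupoid.inv γ, by rw [fibreProj_inv, h, inv_inv]⟩

theorem monodromy_fibreProj (hp : IsCoveringMap p) {a b : PiOneOn (p ⁻¹' {x})} (γ : a ⟶ b) :
    hp.monodromy (fibreProj p x γ) ⟨a.pt, a.mem⟩ = ⟨b.pt, b.mem⟩ := by
  refine hp.monodromy_eq_of_map_eq (ex := ⟨a.pt, a.mem⟩) (ey := ⟨b.pt, b.mem⟩)
    (show Path.Homotopic.Quotient a.pt b.pt from γ) ?_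
  exact (Path.Homotopic.Quotient.cast_symm_cast
    (Path.Homotopic.Quotient.map (show Path.Homotopic.Quotient a.pt b.pt from γ) p)
    (Eq.symm a.mem) (Eq.symm b.mem)).symm

/-- The reversed morphisms both start at `b`, so each source is the image of `b` under the monodromy
of the same element. -/
theorem source_eq_of_fibreProj_eq (hp : IsCoveringMap p) {a a' b : PiOneOn (p ⁻¹' {x})}
    {γ : a ⟶ b} {γ' : a' ⟶ b} (h : fibreProj p x γ = fibreProj p x γ') : a = a' := by
  have h1 := monodromy_fibreProj hp (Groupoid.inv γ)
  have h2 := monodromy_fibreProj hp (Groupoid.inv γ')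
  rw [fibreProj_inv] at h1 h2
  rw [h, h2] at h1
  exact PiOneOn.ext (congrArg Subtype.val h1).symm

/-! ### The projection of `F̂` to `F` -/

namespace HatGroupoid

variable {F G : Type*} [Group F] [Group G] {φ : F →* G}

theorem proj_injective (a b : HatGroupoid φ) :
    Function.Injective fun f : a ⟶ b => proj f :=
  fun _ _ h => Hom.ext h

theorem proj_comp {a b c : HatGroupoid φ} (f : a ⟶ b) (g : b ⟶ c) :
    proj (f ≫ g) = proj f * proj g := rfl

theorem proj_id (a : HatGroupoid φ) : proj (𝟙 a) = 1 := rfl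

theorem proj_eqToHom {a b : HatGroupoid φ} (h : a = b) : proj (eqToHom h) = 1 := by
  subst h
  rfl

end HatGroupoid

/-! ### The covering groupoid of a covering map determined by a normal subgroup -/

section Coordinate

variable [PathConnectedSpace E] {N : Subgroup (PiOne x)} [N.Normal]
  {xhat : PiOneOn (p ⁻¹' {x})}

/-- The class modulo `N` of the projection of any path from `e` to the base point. -/
noncomputable def fibreCoord (N : Subgroup (PiOne x)) [N.Normal] (xhat e : PiOneOn (p ⁻¹' {x})) :
    PiOne x ⧸ N :=
  QuotientGroup.mk' N (fibreProj p x (PiOneOn.nonempty_hom e xhat).some)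

/-- Two paths from `e` to `xhat` differ by a loop at `xhat`, whose projection lies in `N`; the
choice of path is immaterial. -/
theorem fibreCoord_eq (hN : (fibrePush p x xhat).range = N) {e : PiOneOn (p ⁻¹' {x})}
    (γ : e ⟶ xhat) : fibreCoord N xhat e = QuotientGroup.mk' N (fibreProj p x γ) := by
  set γ₀ := (PiOneOn.nonempty_hom e xhat).some with hγ₀
  change QuotientGroup.mk' N (fibreProj p x γ₀) = _
  rw [QuotientGroup.mk'_apply, QuotientGroup.mk'_apply, QuotientGroup.eq, ← fibreProj_inv,
    ← fibreProj_comp, ← hN]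
  exact ⟨Groupoid.inv γ₀ ≫ γ, rfl⟩

theorem fibreCoord_base (hN : (fibrePush p x xhat).range = N) : fibreCoord N xhat xhat = 1 := by
  rw [fibreCoord_eq hN (𝟙 xhat), fibreProj_id, map_one]

theorem fibreCoord_source (hN : (fibrePush p x xhat).range = N) {e e' : PiOneOn (p ⁻¹' {x})}
    (γ : e ⟶ e') :
    QuotientGroup.mk' N (fibreProj p x γ) * fibreCoord N xhat e' = fibreCoord N xhat e := by
  obtain ⟨δ⟩ := PiOneOn.nonempty_hom e' xhat
  rw [fibreCoord_eq hN δ, fibreCoord_eq hN (γ ≫ δ), fibreProj_comp, map_mul]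

/-- If the coordinates agree, the two projections differ by an element of `N`, which is the
projection of a loop at `xhat`. Appending that loop to one path makes the projections equal, and
unique lifting identifies the sources. -/
theorem fibreCoord_injective (hp : IsCoveringMap p) (hN : (fibrePush p x xhat).range = N) :
    Function.Injective (fibreCoord N xhat) := by
  intro e e' h
  obtain ⟨γ⟩ := PiOneOn.nonempty_hom e xhat
  obtain ⟨γ'⟩ := PiOneOn.nonempty_hom e' xhat
  rw [fibreCoord_eq hN γ, fibreCoord_eq hN γ', QuotientGroup.mk'_apply, QuotientGroup.mk'_apply,
    QuotientGroup.eq, ← hN] at h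
  obtain ⟨n, hn⟩ := h
  change fibreProj p x (show xhat ⟶ xhat from n) = _ at hn
  refine source_eq_of_fibreProj_eq hp (γ := γ ≫ (show xhat ⟶ xhat from n)) (γ' := γ') ?_
  rw [fibreProj_comp, hn, mul_inv_cancel_left]

theorem fibreCoord_surjective (hp : IsCoveringMap p) (hN : (fibrePush p x xhat).range = N) :
    Function.Surjective (fibreCoord N xhat) := by
  intro g
  obtain ⟨u, rfl⟩ := QuotientGroup.mk'_surjective N g
  obtain ⟨e, γ, rfl⟩ := exists_fibreProj_eq hp xhat u
  exact ⟨e, fibreCoord_eq hN γ⟩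

/-- The morphism of groupoids `π₁(E, p⁻¹(x)) → F̂` over `π₁(X, x)`. -/
noncomputable def fibreToHat (hN : (fibrePush p x xhat).range = N) :
    PiOneOn (p ⁻¹' {x}) ⥤ HatGroupoid (QuotientGroup.mk' N) where
  obj e := ⟨fibreCoord N xhat e⟩
  map γ := (⟨fibreProj p x γ, fibreCoord_source hN γ⟩ : HatGroupoid.Hom _ _)
  map_id e := HatGroupoid.Hom.ext (fibreProj_id p x e)
  map_comp γ δ := HatGroupoid.Hom.ext (fibreProj_comp p x γ δ)

/-- The point of the fibre with a given coordinate. -/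
noncomputable def fibrePoint (hp : IsCoveringMap p) (hN : (fibrePush p x xhat).range = N)
    (g : PiOne x ⧸ N) : PiOneOn (p ⁻¹' {x}) :=
  (fibreCoord_surjective hp hN g).choose

theorem fibreCoord_fibrePoint (hp : IsCoveringMap p) (hN : (fibrePush p x xhat).range = N)
    (g : PiOne x ⧸ N) : fibreCoord N xhat (fibrePoint hp hN g) = g :=
  (fibreCoord_surjective hp hN g).choose_spec

/-- Lifting to the prescribed target leaves the source to be identified; its coordinate is forced by
the condition `Hom.src`. -/
theorem exists_fibreProj_eq_proj (hp : IsCoveringMap p) (hN : (fibrePush p x xhat).range = N)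
    {a b : HatGroupoid (QuotientGroup.mk' N)} (m : a ⟶ b) :
    ∃ γ : fibrePoint hp hN a.el ⟶ fibrePoint hp hN b.el,
      fibreProj p x γ = HatGroupoid.proj m := by
  obtain ⟨e, γ, hγ⟩ := exists_fibreProj_eq hp (fibrePoint hp hN b.el) (HatGroupoid.proj m)
  have he : e = fibrePoint hp hN a.el := by
    apply fibreCoord_injective hp hN
    rw [← fibreCoord_source hN γ, fibreCoord_fibrePoint, fibreCoord_fibrePoint, hγ]
    exact HatGroupoid.Hom.src m
  subst he
  exact ⟨γ, hγ⟩

/-- The morphism of groupoids `F̂ → π₁(E, p⁻¹(x))` over `π₁(X, x)`. -/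
noncomputable def hatToFibre (hp : IsCoveringMap p) (hN : (fibrePush p x xhat).range = N) :
    HatGroupoid (QuotientGroup.mk' N) ⥤ PiOneOn (p ⁻¹' {x}) where
  obj a := fibrePoint hp hN a.el
  map m := (exists_fibreProj_eq_proj hp hN m).choose
  map_id a := fibreProj_injective hp _ _ <| by
    dsimp only
    rw [(exists_fibreProj_eq_proj hp hN (𝟙 a)).choose_spec, fibreProj_id, HatGroupoid.proj_id]
  map_comp m n := fibreProj_injective hp _ _ <| by
    dsimp only
    rw [(exists_fibreProj_eq_proj hp hN (m ≫ n)).choose_spec, fibreProj_comp,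
      (exists_fibreProj_eq_proj hp hN m).choose_spec,
      (exists_fibreProj_eq_proj hp hN n).choose_spec, HatGroupoid.proj_comp]

theorem fibreProj_hatToFibre_map (hp : IsCoveringMap p) (hN : (fibrePush p x xhat).range = N)
    {a b : HatGroupoid (QuotientGroup.mk' N)} (m : a ⟶ b) :
    fibreProj p x ((hatToFibre hp hN).map m) = HatGroupoid.proj m :=
  (exists_fibreProj_eq_proj hp hN m).choose_spec

theorem fibrePoint_fibreCoord (hp : IsCoveringMap p) (hN : (fibrePush p x xhat).range = N)
    (e : PiOneOn (p ⁻¹' {x})) : fibrePoint hp hN (fibreCoord N xhat e) = e :=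
  fibreCoord_injective hp hN (fibreCoord_fibrePoint hp hN _)

theorem fibrePoint_one (hp : IsCoveringMap p) (hN : (fibrePush p x xhat).range = N) :
    fibrePoint hp hN 1 = xhat := by
  rw [← fibreCoord_base hN, fibrePoint_fibreCoord]

theorem hatToFibre_comp_fibreToHat (hp : IsCoveringMap p)
    (hN : (fibrePush p x xhat).range = N) : hatToFibre hp hN ⋙ fibreToHat hN = 𝟭 _ := by
  refine CategoryTheory.Functor.ext
    (fun a => HatGroupoid.ext (fibreCoord_fibrePoint hp hN a.el)) fun a b m => ?_
  apply HatGroupoid.proj_injective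
  dsimp only [Functor.id_map]
  -- The identifications of objects project to `1`, so the equation of functors reduces to one in
  -- `F`.
  rw [HatGroupoid.proj_comp, HatGroupoid.proj_comp, HatGroupoid.proj_eqToHom,
    HatGroupoid.proj_eqToHom, one_mul, mul_one]
  exact fibreProj_hatToFibre_map hp hN m

theorem fibreToHat_comp_hatToFibre (hp : IsCoveringMap p)
    (hN : (fibrePush p x xhat).range = N) : fibreToHat hN ⋙ hatToFibre hp hN = 𝟭 _ := by
  refine CategoryTheory.Functor.ext
    (fun e => fibrePoint_fibreCoord hp hN e) fun a b γ => ?_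
  apply fibreProj_injective hp
  have h : fibreProj p x (eqToHom (fibrePoint_fibreCoord hp hN a) ≫ γ ≫
      eqToHom (fibrePoint_fibreCoord hp hN b).symm) = fibreProj p x γ := by
    rw [fibreProj_comp, fibreProj_comp, fibreProj_eqToHom, fibreProj_eqToHom, one_mul, mul_one]
  exact (fibreProj_hatToFibre_map hp hN ((fibreToHat hN).map γ)).trans h.symm

end Coordinate

end CoveringGroupoid

section RelativeHomology

variable {Y : Type*} [TopologicalSpace Y]

/-! ### One-dimensional chains modulo boundaries and null chains -/

/-- The class of a singular `1`-cube in `C₁(Y, A)` modulo boundaries. -/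
def cubeClass (A : Set Y) (σ : SingCube Y 1) :
    FreeAbelianGroup (SingCube Y 1) ⧸ relBoundaries A 1 :=
  QuotientAddGroup.mk' _ (FreeAbelianGroup.of σ)

/-- `H₁(Y, A)` as a subgroup of `C₁(Y, A)` modulo boundaries. -/
def RelHomology.toChainQuotient (A : Set Y) :
    RelHomology A 1 →+ FreeAbelianGroup (SingCube Y 1) ⧸ relBoundaries A 1 :=
  QuotientAddGroup.map _ _ (relCycles A 1).subtype fun _ hc => hc

theorem RelHomology.toChainQuotient_mk (A : Set Y) (c : relCycles A 1) :
    RelHomology.toChainQuotient A (QuotientAddGroup.mk c) =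
      QuotientAddGroup.mk' (relBoundaries A 1) c.1 := rfl

/-- This allows identities in `H₁` to be verified among classes of arbitrary 1-cubes, whose ends
need not lie in `A`. -/
theorem RelHomology.toChainQuotient_injective (A : Set Y) :
    Function.Injective (RelHomology.toChainQuotient A) := by
  rw [injective_iff_map_eq_zero]
  intro c hc
  obtain ⟨c, rfl⟩ := QuotientAddGroup.mk_surjective c
  exact (QuotientAddGroup.eq_zero_iff c).mpr ((QuotientAddGroup.eq_zero_iff c.1).mp hc)

theorem RelHomology.toChainQuotient_pathClass {A : Set Y} {a b : PiOneOn A}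
    (γ : Path a.pt b.pt) :
    RelHomology.toChainQuotient A (pathClass γ) = cubeClass A (pathCube γ) := rfl

theorem cubeClass_eq_zero {A : Set Y} {σ : SingCube Y 1}
    (h : σ.IsDegenerate ∨ ∀ t, σ t ∈ A) : cubeClass A σ = 0 :=
  (QuotientAddGroup.eq_zero_iff _).mpr
    (AddSubgroup.mem_sup_right (AddSubgroup.subset_closure ⟨σ, h, rfl⟩))

theorem cubeClass_eq_zero_of_const {A : Set Y} {σ : SingCube Y 1} (y : Y) (h : ∀ t, σ t = y) :
    cubeClass A σ = 0 :=
  cubeClass_eq_zero (Or.inl ⟨0, fun s t _ => (h s).trans (h t).symm⟩)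

theorem SingCube.face_zero_apply (σ : SingCube Y 2) (ε : unitInterval) (t : Fin 1 → unitInterval) :
    σ.face 0 ε t = σ ![ε, t 0] := by
  change σ _ = σ _
  congr 1
  ext i
  fin_cases i <;> rfl

theorem SingCube.face_one_apply (σ : SingCube Y 2) (ε : unitInterval) (t : Fin 1 → unitInterval) :
    σ.face 1 ε t = σ ![t 0, ε] := by
  change σ _ = σ _
  congr 1
  ext i
  fin_cases i <;> rfl

theorem cubeBoundary_of_square (σ : SingCube Y 2) :
    cubeBoundary Y 1 (FreeAbelianGroup.of σ) =
      (FreeAbelianGroup.of (σ.face 0 1) + FreeAbelianGroup.of (σ.face 1 0)) -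
        (FreeAbelianGroup.of (σ.face 0 0) + FreeAbelianGroup.of (σ.face 1 1)) := by
  rw [cubeBoundary, FreeAbelianGroup.lift_apply_of, Fin.sum_univ_two]
  simp only [Fin.val_zero, Fin.val_one]
  norm_num
  abel

theorem cubeClass_square (A : Set Y) (σ : SingCube Y 2) :
    cubeClass A (σ.face 0 1) + cubeClass A (σ.face 1 0) =
      cubeClass A (σ.face 0 0) + cubeClass A (σ.face 1 1) := by
  rw [← sub_eq_zero]
  simp only [cubeClass]
  rw [← map_add, ← map_add, ← map_sub, ← cubeBoundary_of_square]
  exact (QuotientAddGroup.eq_zero_iff _).mpr (AddSubgroup.mem_sup_left ⟨_, rfl⟩)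

/-- A map from the square, as a singular `2`-cube. -/
def squareCube (H : C(unitInterval × unitInterval, Y)) : SingCube Y 2 :=
  ⟨fun t => H (t 0, t 1), by fun_prop⟩

theorem cubeClass_pathCube_square (A : Set Y) {a b c d : Y} (H : C(unitInterval × unitInterval, Y))
    (l : Path a b) (r : Path c d) (s : Path a c) (t : Path b d)
    (hl : ∀ i, H (0, i) = l i) (hr : ∀ i, H (1, i) = r i)
    (hs : ∀ i, H (i, 0) = s i) (ht : ∀ i, H (i, 1) = t i) :
    cubeClass A (pathCube r) + cubeClass A (pathCube s) =
      cubeClass A (pathCube l) + cubeClass A (pathCube t) := by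
  have h := cubeClass_square A (squareCube H)
  have e1 : (squareCube H).face 0 1 = pathCube r :=
    ContinuousMap.ext fun i => (SingCube.face_zero_apply _ _ _).trans (hr (i 0))
  have e2 : (squareCube H).face 0 0 = pathCube l :=
    ContinuousMap.ext fun i => (SingCube.face_zero_apply _ _ _).trans (hl (i 0))
  have e3 : (squareCube H).face 1 0 = pathCube s :=
    ContinuousMap.ext fun i => (SingCube.face_one_apply _ _ _).trans (hs (i 0))
  have e4 : (squareCube H).face 1 1 = pathCube t :=
    ContinuousMap.ext fun i => (SingCube.face_one_apply _ _ _).trans (ht (i 0))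
  rwa [e1, e2, e3, e4] at h

theorem cubeClass_refl (A : Set Y) (y : Y) : cubeClass A (pathCube (Path.refl y)) = 0 :=
  cubeClass_eq_zero_of_const y fun _ => rfl

/-- A homotopy with fixed ends is a square with two constant sides, and these are degenerate. -/
theorem cubeClass_homotopic (A : Set Y) {a b : Y} {γ γ' : Path a b} (h : γ.Homotopic γ') :
    cubeClass A (pathCube γ) = cubeClass A (pathCube γ') := by
  obtain ⟨H⟩ := h
  have := cubeClass_pathCube_square A H.toContinuousMap γ γ' (Path.refl a) (Path.refl b)
    (fun i => H.apply_zero i) (fun i => H.apply_one i) (fun i => H.source i)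
    (fun i => H.target i)
  rw [cubeClass_refl, cubeClass_refl, add_zero, add_zero] at this
  exact this.symm

/-- The reparametrisation `(s, t) ↦ t + s (1 - t) / 2` of the unit interval. -/
noncomputable def tailReparam : C(unitInterval × unitInterval, unitInterval) :=
  ⟨fun q => ⟨q.2 + q.1 * (1 - q.2) / 2, by
    have h1 := q.1.2.1; have h2 := q.1.2.2; have h3 := q.2.2.1; have h4 := q.2.2.2
    constructor <;> nlinarith [mul_nonneg h1 (sub_nonneg.mpr h4),
      mul_nonneg (sub_nonneg.mpr h2) (sub_nonneg.mpr h4)]⟩, by fun_prop⟩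

/-- Composing `γ.trans δ` with `tailReparam` gives a square: at `s = 0` the whole path, at `s = 1`
its second half `δ`, at `t = 0` its first half `γ`, and at `t = 1` the constant end point. -/
theorem cubeClass_trans (A : Set Y) {a b c : Y} (γ : Path a b) (δ : Path b c) :
    cubeClass A (pathCube (γ.trans δ)) = cubeClass A (pathCube γ) + cubeClass A (pathCube δ) := by
  have := cubeClass_pathCube_square A
    ((γ.trans δ : C(unitInterval, Y)).comp tailReparam) (γ.trans δ) δ γ (Path.refl c)
    (fun i => congrArg (γ.trans δ) (Subtype.ext (by simp [tailReparam])))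
    (fun i => ?_) (fun i => ?_) (fun i => ?_)
  · rw [cubeClass_refl, add_zero] at this
    rw [← this, add_comm]
  · change (γ.trans δ) (tailReparam (1, i)) = _
    have hv : (tailReparam (1, i) : ℝ) = i + 1 * (1 - i) / 2 := by simp [tailReparam]
    rw [Path.trans_apply]
    split_ifs with h
    -- The value `(1 + i) / 2` lies in the first half only for `i = 0`, where `γ` and `δ` meet.
    · have hi : i = 0 := Subtype.ext (by
        have := i.2.1
        rw [hv] at h
        exact le_antisymm (show (i : ℝ) ≤ 0 by linarith) this)
      subst hi
      rw [Path.source]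
      refine (congrArg γ (Subtype.ext ?_)).trans γ.target
      simp [hv]
    · refine congrArg δ (Subtype.ext ?_)
      simp only [hv]
      ring
  · change (γ.trans δ) (tailReparam (i, 0)) = _
    have hv : (tailReparam (i, 0) : ℝ) = i / 2 := by simp [tailReparam]
    rw [Path.trans_apply, dif_pos (by rw [hv]; linarith [i.2.2])]
    refine congrArg γ (Subtype.ext ?_)
    simp only [hv]
    ring
  · change (γ.trans δ) (tailReparam (i, 1)) = c
    rw [show tailReparam (i, 1) = 1 from Subtype.ext (by simp [tailReparam]), Path.target]

theorem cubeClass_symm (A : Set Y) {a b : Y} (γ : Path a b) :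
    cubeClass A (pathCube γ.symm) = -cubeClass A (pathCube γ) := by
  rw [eq_neg_iff_add_eq_zero, add_comm, ← cubeClass_trans, ← cubeClass_refl A a]
  exact cubeClass_homotopic A ⟨(Path.Homotopy.reflTransSymm γ).symm⟩

/-! ### The map `π₁(Y, A)^totab → H₁(Y, A)` -/

theorem pathClass_homotopic {A : Set Y} {a b : PiOneOn A} {γ γ' : Path a.pt b.pt}
    (h : γ.Homotopic γ') : pathClass γ = pathClass γ' :=
  RelHomology.toChainQuotient_injective A (cubeClass_homotopic A h)

/-- The class in `H₁(Y, A)` of a morphism of `π₁(Y, A)`. -/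
def homClass {A : Set Y} {a b : PiOneOn A} (f : a ⟶ b) : RelHomology A 1 :=
  Quotient.lift (s := Path.Homotopic.setoid a.pt b.pt) (fun γ => pathClass γ)
    (fun _ _ h => pathClass_homotopic h) f

theorem homClass_homMk {A : Set Y} {a b : PiOneOn A} (γ : Path a.pt b.pt) :
    homClass (PiOneOn.homMk γ : a ⟶ b) = pathClass γ := rfl

theorem PiOneOn.homMk_trans {A : Set Y} {a b c : PiOneOn A} (γ : Path a.pt b.pt)
    (δ : Path b.pt c.pt) :
    (PiOneOn.homMk (γ.trans δ) : a ⟶ c) =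
      (PiOneOn.homMk γ : a ⟶ b) ≫ (PiOneOn.homMk δ : b ⟶ c) := rfl

theorem homClass_comp {A : Set Y} {a b c : PiOneOn A} (f : a ⟶ b) (g : b ⟶ c) :
    homClass (f ≫ g) = homClass f + homClass g := by
  obtain ⟨γ, rfl⟩ := PiOneOn.homMk_surjective f
  obtain ⟨δ, rfl⟩ := PiOneOn.homMk_surjective g
  rw [← PiOneOn.homMk_trans, homClass_homMk, homClass_homMk, homClass_homMk]
  apply RelHomology.toChainQuotient_injective
  rw [map_add]
  exact cubeClass_trans A γ δ

/-- The homomorphism `π₁(Y, A)^totab → H₁(Y, A)` sending a path to its class. -/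
noncomputable def totabToHomology (A : Set Y) : Totab (PiOneOn A) →+ RelHomology A 1 :=
  Totab.lift (fun f => homClass f) fun f g => homClass_comp f g

theorem totabToHomology_of {A : Set Y} {a b : PiOneOn A} (f : a ⟶ b) :
    totabToHomology A (Totab.of f) = homClass f :=
  Totab.lift_of _ _ f

/-! ### The inverse map -/

open Classical in
/-- A path to `y` from a point of `A`, constant if `y` lies in `A`. -/
noncomputable def anchor [PathConnectedSpace Y] {A : Set Y} (a₀ : PiOneOn A) (y : Y) :
    Σ a : PiOneOn A, Path a.pt y :=
  if h : y ∈ A then ⟨⟨y, h⟩, Path.refl y⟩ else ⟨a₀, PathConnectedSpace.somePath a₀.pt y⟩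

theorem anchor_of_mem [PathConnectedSpace Y] {A : Set Y} (a₀ a : PiOneOn A) :
    anchor a₀ a.pt = ⟨a, Path.refl a.pt⟩ :=
  dif_pos a.mem

/-- The morphism of `π₁(Y, A)` obtained from a path by adding the paths `anchor` at its ends. -/
noncomputable def anchoredHom [PathConnectedSpace Y] {A : Set Y} (a₀ : PiOneOn A) {y z : Y}
    (γ : Path y z) : (anchor a₀ y).1 ⟶ (anchor a₀ z).1 :=
  PiOneOn.homMk (((anchor a₀ y).2.trans γ).trans (anchor a₀ z).2.symm)

/-- The class in `π₁(Y, A)^totab` of a path of `Y`. -/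
noncomputable def arcClass [PathConnectedSpace Y] {A : Set Y} (a₀ : PiOneOn A) {y z : Y}
    (γ : Path y z) : Totab (PiOneOn A) :=
  Totab.of (anchoredHom a₀ γ)

/-- A singular `1`-cube regarded as a path. -/
def cubePath (σ : SingCube Y 1) : Path (σ fun _ => 0) (σ fun _ => 1) where
  toFun t := σ fun _ => t
  source' := rfl
  target' := rfl

theorem pathCube_cubePath (σ : SingCube Y 1) : pathCube (cubePath σ) = σ := by
  ext t
  change σ _ = σ _
  congr 1
  ext i
  rw [Subsingleton.elim i 0]

section Arc

variable [PathConnectedSpace Y] {A : Set Y} (a₀ : PiOneOn A)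

theorem arcClass_congr {y z y' z' : Y} {γ : Path y z} {γ' : Path y' z'}
    (h : ∀ t, γ t = γ' t) : arcClass a₀ γ = arcClass a₀ γ' := by
  obtain rfl : y = y' := by simpa using h 0
  obtain rfl : z = z' := by simpa using h 1
  rw [Path.ext (funext h)]

theorem arcClass_homotopic {y z : Y} {γ γ' : Path y z} (h : γ.Homotopic γ') :
    arcClass a₀ γ = arcClass a₀ γ' :=
  congrArg Totab.of (Path.Homotopic.Quotient.eq.mpr
    (((Path.Homotopic.refl _).hcomp h).hcomp (Path.Homotopic.refl _)))

/-- The anchor at `z` is traversed backwards and then forwards, so it cancels. -/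
theorem arcClass_trans {y z t : Y} (γ : Path y z) (δ : Path z t) :
    arcClass a₀ (γ.trans δ) = arcClass a₀ γ + arcClass a₀ δ := by
  rw [arcClass, arcClass, arcClass, ← Totab.of_comp]
  congr 1
  let α {w : Y} : FundamentalGroupoid.mk (anchor a₀ w).1.pt ⟶ FundamentalGroupoid.mk w :=
    Path.Homotopic.Quotient.mk (anchor a₀ w).2
  let g : FundamentalGroupoid.mk y ⟶ FundamentalGroupoid.mk z := Path.Homotopic.Quotient.mk γ
  let d : FundamentalGroupoid.mk z ⟶ FundamentalGroupoid.mk t := Path.Homotopic.Quotient.mk δ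
  change (α ≫ g ≫ d) ≫ Groupoid.inv α =
    ((α ≫ g) ≫ Groupoid.inv α) ≫ ((α ≫ d) ≫ Groupoid.inv α)
  have hα : Groupoid.inv α ≫ α ≫ d ≫ Groupoid.inv α = d ≫ Groupoid.inv α := by
    rw [← Category.assoc, Groupoid.inv_comp, Category.id_comp]
  simp only [Category.assoc]
  rw [hα]

/-- The constant path is its own square under composition, so its class equals its double. -/
theorem arcClass_refl (y : Y) : arcClass a₀ (Path.refl y) = 0 := by
  have h := arcClass_trans a₀ (Path.refl y) (Path.refl y)
  rw [Path.refl_trans_refl] at h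
  exact left_eq_add.mp h

theorem arcClass_const {y z : Y} (γ : Path y z) (w : Y) (h : ∀ t, γ t = w) :
    arcClass a₀ γ = 0 := by
  rw [← arcClass_refl a₀ w]
  exact arcClass_congr a₀ h

theorem arcClass_of_mem {a b : PiOneOn A} (γ : Path a.pt b.pt) :
    arcClass a₀ γ = Totab.of (PiOneOn.homMk γ : a ⟶ b) := by
  -- The anchors occur in the types of the ends; generalising each pair of point and path allows it
  -- to be replaced by the constant one.
  have key : ∀ (s : Σ c : PiOneOn A, Path c.pt a.pt) (t : Σ c : PiOneOn A, Path c.pt b.pt),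
      s = ⟨a, Path.refl a.pt⟩ → t = ⟨b, Path.refl b.pt⟩ →
      Totab.of (PiOneOn.homMk ((s.2.trans γ).trans t.2.symm) : s.1 ⟶ t.1) =
        Totab.of (PiOneOn.homMk γ : a ⟶ b) := by
    rintro _ _ rfl rfl
    refine congrArg Totab.of (Path.Homotopic.Quotient.eq.mpr ?_)
    dsimp only
    rw [Path.refl_symm]
    exact Path.Homotopic.trans ⟨Path.Homotopy.transRefl _⟩ ⟨Path.Homotopy.reflTrans _⟩
  exact key _ _ (anchor_of_mem a₀ a) (anchor_of_mem a₀ b)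

/-- The restriction of a map of the square to a path in the square. -/
def squarePath (H : C(unitInterval × unitInterval, Y))
    {q r : unitInterval × unitInterval} (γ : Path q r) : Path (H q) (H r) :=
  γ.map H.continuous

/-- The unit square is contractible, hence the two routes are homotopic in it, and so are their
images under `H`. -/
theorem arcClass_square (H : C(unitInterval × unitInterval, Y))
    {q r s t : unitInterval × unitInterval} (γ₁ : Path q r) (γ₂ : Path r t)
    (γ₃ : Path q s) (γ₄ : Path s t) :
    arcClass a₀ (squarePath H γ₁) + arcClass a₀ (squarePath H γ₂) =
      arcClass a₀ (squarePath H γ₃) + arcClass a₀ (squarePath H γ₄) := by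
  have : ContractibleSpace unitInterval := (convex_Icc (0 : ℝ) 1).contractibleSpace ⟨0, by simp⟩
  have h := SimplyConnectedSpace.paths_homotopic (γ₁.trans γ₂) (γ₃.trans γ₄)
  have h' := arcClass_homotopic a₀ (h.map H)
  rw [Path.map_trans, Path.map_trans, arcClass_trans, arcClass_trans] at h'
  exact h'

/-- The homomorphism `C₁(Y) → π₁(Y, A)^totab` given by `arcClass`. -/
noncomputable def chainsToTotab : FreeAbelianGroup (SingCube Y 1) →+ Totab (PiOneOn A) :=
  FreeAbelianGroup.lift fun σ => arcClass a₀ (cubePath σ)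

theorem chainsToTotab_of (σ : SingCube Y 1) :
    chainsToTotab a₀ (FreeAbelianGroup.of σ) = arcClass a₀ (cubePath σ) :=
  FreeAbelianGroup.lift_apply_of _ σ

theorem chainsToTotab_boundary (c : FreeAbelianGroup (SingCube Y 2)) :
    chainsToTotab a₀ (cubeBoundary Y 1 c) = 0 := by
  suffices h : (chainsToTotab a₀).comp (cubeBoundary Y 1) = 0 from DFunLike.congr_fun h c
  refine FreeAbelianGroup.lift_ext _ _ fun σ => ?_
  rw [AddMonoidHom.comp_apply, cubeBoundary_of_square, AddMonoidHom.zero_apply, map_sub, map_add,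
    map_add, sub_eq_zero]
  simp only [chainsToTotab_of]
  let H : C(unitInterval × unitInterval, Y) := ⟨fun q => σ ![q.1, q.2], by fun_prop⟩
  let v (ε : unitInterval) : Path ((ε, 0) : unitInterval × unitInterval) (ε, 1) :=
    ⟨⟨fun t => (ε, t), by fun_prop⟩, rfl, rfl⟩
  let h (ε : unitInterval) : Path ((0, ε) : unitInterval × unitInterval) (1, ε) :=
    ⟨⟨fun t => (t, ε), by fun_prop⟩, rfl, rfl⟩
  have hv (ε : unitInterval) :
      arcClass a₀ (cubePath (σ.face 0 ε)) = arcClass a₀ (squarePath H (v ε)) :=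
    arcClass_congr a₀ fun t => SingCube.face_zero_apply σ ε _
  have hh (ε : unitInterval) :
      arcClass a₀ (cubePath (σ.face 1 ε)) = arcClass a₀ (squarePath H (h ε)) :=
    arcClass_congr a₀ fun t => SingCube.face_one_apply σ ε _
  rw [hv, hv, hh, hh, add_comm]
  exact arcClass_square a₀ H (h 0) (v 1) (v 0) (h 1)

/-- In dimension one a degenerate cube is constant, and `hA` makes every cube lying in `A` constant
too; constant paths have class zero. -/
theorem chainsToTotab_relBoundaries
    (hA : ∀ γ : C(unitInterval, Y), (∀ t, γ t ∈ A) → ∀ t, γ t = γ 0) :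
    relBoundaries A 1 ≤ (chainsToTotab a₀).ker := by
  refine sup_le ?_ ?_
  · rintro _ ⟨c, rfl⟩
    exact chainsToTotab_boundary a₀ c
  · rw [nullChains, AddSubgroup.closure_le]
    rintro _ ⟨σ, hσ, rfl⟩
    change chainsToTotab a₀ _ = 0
    rw [chainsToTotab_of]
    refine arcClass_const a₀ _ (σ fun _ => 0) ?_
    rcases hσ with ⟨i, hi⟩ | hσ
    · exact fun t => hi _ _ fun j hj => (hj (Subsingleton.elim j i)).elim
    · exact hA (cubePath σ) fun t => hσ _

/-- The homomorphism induced by `chainsToTotab` on chains modulo boundaries. -/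
noncomputable def chainQuotientToTotab
    (hA : ∀ γ : C(unitInterval, Y), (∀ t, γ t ∈ A) → ∀ t, γ t = γ 0) :
    FreeAbelianGroup (SingCube Y 1) ⧸ relBoundaries A 1 →+ Totab (PiOneOn A) :=
  QuotientAddGroup.lift _ (chainsToTotab a₀) (chainsToTotab_relBoundaries a₀ hA)

theorem chainQuotientToTotab_totabToHomology
    (hA : ∀ γ : C(unitInterval, Y), (∀ t, γ t ∈ A) → ∀ t, γ t = γ 0) (m : Totab (PiOneOn A)) :
    chainQuotientToTotab a₀ hA (RelHomology.toChainQuotient A (totabToHomology A m)) = m := by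
  suffices h : ((chainQuotientToTotab a₀ hA).comp (RelHomology.toChainQuotient A)).comp
      (totabToHomology A) = AddMonoidHom.id _ from DFunLike.congr_fun h m
  refine Totab.hom_ext fun {a b} f => ?_
  obtain ⟨γ, rfl⟩ := PiOneOn.homMk_surjective f
  simp only [AddMonoidHom.comp_apply, totabToHomology_of, homClass_homMk,
    RelHomology.toChainQuotient_pathClass, AddMonoidHom.id_apply]
  refine (chainsToTotab_of a₀ (pathCube γ)).trans ?_
  rw [← arcClass_of_mem a₀ γ]
  exact arcClass_congr a₀ fun t => rfl

/-- The homomorphism on `0`-chains sending a point to the class of its path `anchor`. -/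
noncomputable def anchorClass :
    FreeAbelianGroup (SingCube Y 0) →+ FreeAbelianGroup (SingCube Y 1) ⧸ relBoundaries A 1 :=
  FreeAbelianGroup.lift fun σ => cubeClass A (pathCube (anchor a₀ (σ Fin.elim0)).2)

/-- A 0-cube has no coordinate and so is never degenerate; at a point of `A` the anchor is constant.
-/
theorem anchorClass_null : nullChains A 0 ≤ (anchorClass a₀).ker := by
  rw [nullChains, AddSubgroup.closure_le]
  rintro _ ⟨σ, hσ, rfl⟩
  change anchorClass a₀ _ = 0
  rw [anchorClass, FreeAbelianGroup.lift_apply_of]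
  rcases hσ with ⟨i, -⟩ | hσ
  · exact i.elim0
  · rw [anchor_of_mem a₀ ⟨σ Fin.elim0, hσ _⟩, cubeClass_refl]

/-- Closing up a cube adds the anchor of its start and subtracts that of its end, a correction
factoring through the boundary. It therefore vanishes on relative cycles, which yields surjectivity
of `totabToHomology`. -/
theorem totabToHomology_chainsToTotab (c : FreeAbelianGroup (SingCube Y 1)) :
    RelHomology.toChainQuotient A (totabToHomology A (chainsToTotab a₀ c)) =
      QuotientAddGroup.mk' _ c - anchorClass a₀ (cubeBoundary Y 0 c) := by
  suffices h : ((RelHomology.toChainQuotient A).comp (totabToHomology A)).comp (chainsToTotab a₀) =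
      QuotientAddGroup.mk' _ - (anchorClass a₀).comp (cubeBoundary Y 0) from DFunLike.congr_fun h c
  refine FreeAbelianGroup.lift_ext _ _ fun σ => ?_
  have hb : cubeBoundary Y 0 (FreeAbelianGroup.of σ) =
      FreeAbelianGroup.of (σ.face 0 1) - FreeAbelianGroup.of (σ.face 0 0) := by
    rw [cubeBoundary, FreeAbelianGroup.lift_apply_of, Fin.sum_univ_one]
    simp
  have hf (ε : unitInterval) : anchorClass a₀ (FreeAbelianGroup.of (σ.face 0 ε)) =
      cubeClass A (pathCube (anchor a₀ (σ fun _ => ε)).2) := by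
    have : σ.face 0 ε Fin.elim0 = σ fun _ => ε := by
      change σ _ = σ _
      congr 1
      ext i
      fin_cases i
      rfl
    rw [anchorClass, FreeAbelianGroup.lift_apply_of, this]
  rw [AddMonoidHom.sub_apply]
  simp only [AddMonoidHom.comp_apply]
  rw [hb, map_sub, hf, hf, chainsToTotab_of, arcClass, anchoredHom, totabToHomology_of,
    homClass_homMk, RelHomology.toChainQuotient_pathClass, cubeClass_trans, cubeClass_trans,
    cubeClass_symm, pathCube_cubePath]
  change _ = cubeClass A σ - _
  abel

theorem totabToHomology_bijective (a₀ : PiOneOn A)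
    (hA : ∀ γ : C(unitInterval, Y), (∀ t, γ t ∈ A) → ∀ t, γ t = γ 0) :
    Function.Bijective (totabToHomology A) := by
  refine ⟨fun m m' h => ?_, fun c => ?_⟩
  · rw [← chainQuotientToTotab_totabToHomology a₀ hA m, h,
      chainQuotientToTotab_totabToHomology]
  obtain ⟨c, rfl⟩ := QuotientAddGroup.mk_surjective c
  refine ⟨chainsToTotab a₀ c, RelHomology.toChainQuotient_injective A ?_⟩
  rw [totabToHomology_chainsToTotab, RelHomology.toChainQuotient_mk]
  have h : anchorClass a₀ (cubeBoundary Y 0 c.1) = 0 := anchorClass_null a₀ c.2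
  rw [h, sub_zero]

end Arc

/-- The interval is connected, so a lift of a constant path is constant. -/
theorem IsCoveringMap.const_of_mem_fibre {E X : Type*} [TopologicalSpace E] [TopologicalSpace X]
    {p : E → X} (hp : IsCoveringMap p) (x : X)
    (γ : C(unitInterval, E)) (h : ∀ t, γ t ∈ p ⁻¹' {x}) (t : unitInterval) :
    γ t = γ 0 :=
  hp.const_of_comp γ.continuous (fun s t => (h s).trans (h t).symm) t 0

end RelativeHomology

theorem Totab.map_of {C D : Type*} [Groupoid C] [Groupoid D] (T : C ⥤ D) {a b : C} (f : a ⟶ b) :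
    Totab.map T (Totab.of f) = Totab.of (T.map f) :=
  Totab.lift_of (fun f => Totab.of (T.map f))
    (fun f g => by rw [T.map_comp, Totab.of_comp]) f

/-! ### The universal derivation with values in `F̂^totab` -/

section Derivation

variable {F G : Type*} [Group F] [Group G] (φ : F →* G)

/-- The function `u ↦ υ (u, 1)` from `F` to `F̂^totab`. -/
def hatDerivation (u : F) : Totab (HatGroupoid φ) :=
  Totab.of (show (⟨φ u⟩ : HatGroupoid φ) ⟶ ⟨1⟩ from
    (⟨u, mul_one _⟩ : HatGroupoid.Hom ⟨φ u⟩ ⟨1⟩))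

theorem op_smul_totab_of (k : G) {a b : HatGroupoid φ} (m : a ⟶ b) :
    op k • Totab.of m = Totab.of ((HatGroupoid.translate k).map m) :=
  Totab.map_of (HatGroupoid.translate k) m

/-- Since `(u, g)` is the translate of `(u, 1)` by `g`, the values of `hatDerivation` generate
`F̂^totab` as a `G`-module; this gives uniqueness in the universal property. -/
theorem totab_of_eq_smul_hatDerivation {a b : HatGroupoid φ} (m : a ⟶ b) :
    Totab.of m = op b.el • hatDerivation φ (HatGroupoid.proj m) := by
  rw [hatDerivation, op_smul_totab_of]
  exact Totab.of_congr (HatGroupoid.ext (HatGroupoid.Hom.src m).symm)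
    (HatGroupoid.ext (one_mul _).symm) rfl

theorem isDerivationOver_hatDerivation : IsDerivationOver φ (hatDerivation φ) := by
  intro u v
  let m : (⟨φ u * φ v⟩ : HatGroupoid φ) ⟶ ⟨φ v⟩ :=
    (⟨u, rfl⟩ : HatGroupoid.Hom (φ := φ) ⟨φ u * φ v⟩ ⟨φ v⟩)
  let n : (⟨φ v⟩ : HatGroupoid φ) ⟶ ⟨1⟩ :=
    (⟨v, mul_one _⟩ : HatGroupoid.Hom (φ := φ) ⟨φ v⟩ ⟨1⟩)
  have hm : op (φ v) • hatDerivation φ u = Totab.of m :=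
    (totab_of_eq_smul_hatDerivation φ m).symm
  rw [hm]
  -- The derivation rule is the factorisation `(u v, 1) = (u, φ v) (v, 1)`.
  refine Eq.trans ?_ (Totab.of_comp m n)
  exact Totab.of_congr (HatGroupoid.ext (map_mul φ u v)) rfl rfl

theorem isUniversalDerivation_hatDerivation :
    IsUniversalDerivation.{w} φ (hatDerivation φ) := by
  refine ⟨isDerivationOver_hatDerivation φ, fun M _ _ d hd => ?_⟩
  -- The formula `(u, g) ↦ (d u) ^ g` is forced by equivariance.
  let L : Totab (HatGroupoid φ) →+ M :=
    Totab.lift (fun {_ b} m => op b.el • d (HatGroupoid.proj m)) fun {a b c} f g => by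
      rw [HatGroupoid.proj_comp, hd, smul_add, smul_smul, ← op_mul]
      congr 3
      exact HatGroupoid.Hom.src g
  have hL {a b : HatGroupoid φ} (m : a ⟶ b) :
      L (Totab.of m) = op b.el • d (HatGroupoid.proj m) := Totab.lift_of _ _ m
  have hsmul (k : Gᵐᵒᵖ) (t : Totab (HatGroupoid φ)) : L (k • t) = k • L t := by
    suffices h : L.comp (DistribSMul.toAddMonoidHom _ k) =
        (DistribSMul.toAddMonoidHom M k).comp L from DFunLike.congr_fun h t
    refine Totab.hom_ext fun {a b} m => ?_
    change L (op k.unop • Totab.of m) = k • L (Totab.of m)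
    rw [op_smul_totab_of, hL, hL, smul_smul]
    rfl
  refine ⟨{ L with map_smul' := hsmul }, fun u => ?_, fun d' hd' => ?_⟩
  · exact (hL _).trans (one_smul _ _)
  · ext t
    suffices h : (d' : Totab (HatGroupoid φ) →+ M) = L from DFunLike.congr_fun h t
    refine Totab.hom_ext fun {a b} m => ?_
    change d' (Totab.of m) = _
    rw [hL, totab_of_eq_smul_hatDerivation, map_smul, hd']

variable {φ}

theorem IsUniversalDerivation.of_addEquiv {D D' : Type*} [AddCommGroup D] [AddCommGroup D']
    [DistribMulAction Gᵐᵒᵖ D] [DistribMulAction Gᵐᵒᵖ D'] {δ : F → D}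
    (hδ : IsUniversalDerivation.{w} φ δ) (e : D ≃+ D')
    (he : ∀ (k : Gᵐᵒᵖ) (t : D), e (k • t) = k • e t) :
    IsUniversalDerivation.{w} φ fun u => e (δ u) := by
  refine ⟨fun u v => by dsimp only; rw [hδ.1, map_add, he], fun M _ _ d hd => ?_⟩
  obtain ⟨d', hd', huniq⟩ := hδ.2 M d hd
  have he' (k : Gᵐᵒᵖ) (t : D') : e.symm (k • t) = k • e.symm t := by
    rw [AddEquiv.symm_apply_eq, he, AddEquiv.apply_symm_apply]
  let E : D →+[Gᵐᵒᵖ] D' := { (e : D →+ D') with map_smul' := he }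
  let E' : D' →+[Gᵐᵒᵖ] D := { (e.symm : D' →+ D) with map_smul' := he' }
  refine ⟨d'.comp E', fun u => ?_, fun d'' hd'' => ?_⟩
  · change d' (e.symm (e (δ u))) = d u
    rw [AddEquiv.symm_apply_apply, hd']
  · rw [← huniq (d''.comp E) hd'']
    ext t
    change d'' t = d'' (e (e.symm t))
    rw [AddEquiv.apply_symm_apply]

end Derivation

/-! ### Transport of structure along isomorphisms -/

/-- The transport of a distributive action along an isomorphism of abelian groups. -/
abbrev AddEquiv.transportDistribMulAction {R A B : Type*} [Monoid R] [AddCommGroup A]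
    [AddCommGroup B] [DistribMulAction R A] (e : A ≃+ B) : DistribMulAction R B where
  smul k c := e (k • e.symm c)
  one_smul c := by
    change e ((1 : R) • e.symm c) = c
    rw [one_smul, AddEquiv.apply_symm_apply]
  mul_smul k l c := by
    change e ((k * l) • e.symm c) = e (k • e.symm (e (l • e.symm c)))
    rw [mul_smul, AddEquiv.symm_apply_apply]
  smul_zero k := by
    change e (k • e.symm 0) = 0
    rw [map_zero, smul_zero, map_zero]
  smul_add k c c' := by
    change e (k • e.symm (c + c')) = e (k • e.symm c) + e (k • e.symm c')
    rw [map_add, smul_add, map_add]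

theorem Totab.map_map_of_comp_eq_id {C D : Type*} [Groupoid C] [Groupoid D] {T : C ⥤ D}
    {S : D ⥤ C} (h : T ⋙ S = 𝟭 C) (t : Totab C) : Totab.map S (Totab.map T t) = t := by
  have h1 : (Totab.map S).comp (Totab.map T) = Totab.map (T ⋙ S) :=
    Totab.hom_ext fun f => by
      rw [AddMonoidHom.comp_apply, Totab.map_of, Totab.map_of, Totab.map_of, Functor.comp_map]
  have h2 : Totab.map (𝟭 C) = AddMonoidHom.id (Totab C) :=
    Totab.hom_ext fun f => Totab.map_of (𝟭 C) f
  rw [h, h2] at h1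
  exact DFunLike.congr_fun h1 t

/-- The isomorphism of universal abelianisations induced by an isomorphism of groupoids. -/
def Totab.mapEquiv {C D : Type*} [Groupoid C] [Groupoid D] (T : C ⥤ D) (S : D ⥤ C)
    (h : T ⋙ S = 𝟭 C) (h' : S ⋙ T = 𝟭 D) : Totab C ≃+ Totab D where
  toFun := Totab.map T
  invFun := Totab.map S
  left_inv := Totab.map_map_of_comp_eq_id h
  right_inv := Totab.map_map_of_comp_eq_id h'
  map_add' := map_add _

/-! ### The homology of the covering space as a `G`-module -/

section Covering

variable {E X : Type*} [TopologicalSpace E] [TopologicalSpace X] {p : C(E, X)} {x : X}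

/-- Morphisms over the same element of `π₁(X, x)` with the same ends have the same class. -/
theorem homClass_eq_of_fibreProj_eq (hp : IsCoveringMap p) {a b a' b' : PiOneOn (p ⁻¹' {x})}
    {f : a ⟶ b} {f' : a' ⟶ b'} (ha : a = a') (hb : b = b')
    (h : fibreProj p x f = fibreProj p x f') : homClass f = homClass f' := by
  subst ha hb
  rw [fibreProj_injective hp a b h]

/-! ### Covering transformations -/

/-- The action of a map over the base on the points of a fibre. -/
def deckPoint (h : C(E, E)) (hh : ∀ z, p (h z) = p z) (e : PiOneOn (p ⁻¹' {x})) :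
    PiOneOn (p ⁻¹' {x}) :=
  ⟨h e.pt, (hh e.pt).trans e.mem⟩

/-- The action of a map over the base on paths between points of a fibre. -/
def deckPath (h : C(E, E)) (hh : ∀ z, p (h z) = p z) {a b : PiOneOn (p ⁻¹' {x})}
    (γ : Path a.pt b.pt) : Path (deckPoint h hh a).pt (deckPoint h hh b).pt :=
  γ.map h.continuous

theorem fibreProj_deckPath (h : C(E, E)) (hh : ∀ z, p (h z) = p z) {a b : PiOneOn (p ⁻¹' {x})}
    (γ : Path a.pt b.pt) :
    fibreProj p x (PiOneOn.homMk (deckPath h hh γ)) =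
      fibreProj p x (PiOneOn.homMk γ : a ⟶ b) := by
  change Path.Homotopic.Quotient.mk _ = Path.Homotopic.Quotient.mk _
  congr 1
  ext t
  exact hh (γ t)

theorem map_pathClass_deckPath (h : C(E, E)) (hh : ∀ z, p (h z) = p z)
    {a b : PiOneOn (p ⁻¹' {x})} (γ : Path a.pt b.pt) :
    RelHomology.map h (A := p ⁻¹' {x}) (B := p ⁻¹' {x}) (fun z hz => (hh z).trans hz) 1
      (pathClass γ) = pathClass (deckPath h hh γ) := by
  apply RelHomology.toChainQuotient_injective
  exact congrArg (QuotientAddGroup.mk' (relBoundaries (p ⁻¹' {x}) 1))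
    (FreeAbelianGroup.map_of_apply (f := fun σ => h.comp σ) (pathCube γ))

variable [PathConnectedSpace E] {N : Subgroup (PiOne x)} [N.Normal] {xhat : PiOneOn (p ⁻¹' {x})}

/-- The image under `h` of a path from `e` to `xhat` has the same projection and ends at `h xhat`,
so only the right-hand factor changes. -/
theorem fibreCoord_deckPoint (hN : (fibrePush p x xhat).range = N) (h : C(E, E))
    (hh : ∀ z, p (h z) = p z) (e : PiOneOn (p ⁻¹' {x})) :
    fibreCoord N xhat (deckPoint h hh e) =
      fibreCoord N xhat e * fibreCoord N xhat (deckPoint h hh xhat) := by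
  obtain ⟨f⟩ := PiOneOn.nonempty_hom e xhat
  obtain ⟨γ, rfl⟩ := PiOneOn.homMk_surjective f
  rw [fibreCoord_eq hN (PiOneOn.homMk γ), ← fibreProj_deckPath h hh γ]
  exact (fibreCoord_source hN _).symm

theorem deckPoint_fibrePoint (hp : IsCoveringMap p) (hN : (fibrePush p x xhat).range = N)
    (h : C(E, E)) (hh : ∀ z, p (h z) = p z) {k : PiOne x ⧸ N}
    (hk : deckPoint h hh xhat = fibrePoint hp hN k) (g : PiOne x ⧸ N) :
    deckPoint h hh (fibrePoint hp hN g) = fibrePoint hp hN (g * k) := by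
  apply fibreCoord_injective hp hN
  rw [fibreCoord_deckPoint hN, hk, fibreCoord_fibrePoint, fibreCoord_fibrePoint,
    fibreCoord_fibrePoint]

/-- The isomorphism `F̂^totab ≃ H₁(E, p⁻¹(x))`. -/
noncomputable def hatTotabEquiv (hp : IsCoveringMap p) (hN : (fibrePush p x xhat).range = N) :
    Totab (HatGroupoid (QuotientGroup.mk' N)) ≃+ RelHomology (p ⁻¹' {x}) 1 :=
  (Totab.mapEquiv _ _ (hatToFibre_comp_fibreToHat hp hN)
    (fibreToHat_comp_hatToFibre hp hN)).trans
    (AddEquiv.ofBijective (totabToHomology (p ⁻¹' {x}))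
      (totabToHomology_bijective xhat (hp.const_of_mem_fibre x)))

theorem hatTotabEquiv_of (hp : IsCoveringMap p) (hN : (fibrePush p x xhat).range = N)
    {a b : HatGroupoid (QuotientGroup.mk' N)} (m : a ⟶ b) :
    hatTotabEquiv hp hN (Totab.of m) = homClass ((hatToFibre hp hN).map m) := by
  change totabToHomology _ (Totab.map (hatToFibre hp hN) (Totab.of m)) = _
  rw [Totab.map_of, totabToHomology_of]

/-- It suffices to compare generators. The lift of the translate of `m` by `k` and the image under
`h` of the lift of `m` have the same ends and projection, so they coincide. -/
theorem hatTotabEquiv_op_smul (hp : IsCoveringMap p) (hN : (fibrePush p x xhat).range = N)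
    (h : C(E, E)) (hh : ∀ z, p (h z) = p z) {k : PiOne x ⧸ N}
    (hk : deckPoint h hh xhat = fibrePoint hp hN k)
    (t : Totab (HatGroupoid (QuotientGroup.mk' N))) :
    hatTotabEquiv hp hN (op k • t) =
      RelHomology.map h (A := p ⁻¹' {x}) (B := p ⁻¹' {x}) (fun z hz => (hh z).trans hz) 1
        (hatTotabEquiv hp hN t) := by
  suffices H : ((hatTotabEquiv hp hN : _ →+ RelHomology (p ⁻¹' {x}) 1)).comp
      (DistribSMul.toAddMonoidHom _ (op k)) =
      (RelHomology.map h (A := p ⁻¹' {x}) (B := p ⁻¹' {x}) (fun z hz => (hh z).trans hz) 1).comp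
        (hatTotabEquiv hp hN : _ →+ RelHomology (p ⁻¹' {x}) 1) from DFunLike.congr_fun H t
  refine Totab.hom_ext fun {a b} m => ?_
  change hatTotabEquiv hp hN (op k • Totab.of m) =
    RelHomology.map h (A := p ⁻¹' {x}) (B := p ⁻¹' {x}) (fun z hz => (hh z).trans hz) 1
      (hatTotabEquiv hp hN (Totab.of m))
  obtain ⟨γ, hγ⟩ := PiOneOn.homMk_surjective ((hatToFibre hp hN).map m)
  rw [op_smul_totab_of, hatTotabEquiv_of, hatTotabEquiv_of, ← hγ, homClass_homMk,
    map_pathClass_deckPath h hh γ, ← homClass_homMk]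
  refine homClass_eq_of_fibreProj_eq hp (deckPoint_fibrePoint hp hN h hh hk a.el).symm
    (deckPoint_fibrePoint hp hN h hh hk b.el).symm ?_
  rw [fibreProj_deckPath, hγ, fibreProj_hatToFibre_map, fibreProj_hatToFibre_map]
  rfl

/-- The image of `(u, 1)` is a lift of `u` ending at `xhat`, and `γ` represents another; such a lift
is unique. -/
theorem hatTotabEquiv_hatDerivation (hp : IsCoveringMap p)
    (hN : (fibrePush p x xhat).range = N) {e : PiOneOn (p ⁻¹' {x})} (γ : Path e.pt xhat.pt) :
    hatTotabEquiv hp hN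
      (hatDerivation (QuotientGroup.mk' N) (fibreProj p x (PiOneOn.homMk γ))) = pathClass γ := by
  rw [hatDerivation, hatTotabEquiv_of, ← homClass_homMk]
  refine homClass_eq_of_fibreProj_eq hp ?_ (fibrePoint_one hp hN) ?_
  · change fibrePoint hp hN (QuotientGroup.mk' N _) = e
    rw [← fibreCoord_eq hN, fibrePoint_fibreCoord]
  · exact fibreProj_hatToFibre_map hp hN _

end Covering

/-! ### Assembly of the theorem -/

theorem mainTheorem4 {X : Type u} {Xhat : Type v} [TopologicalSpace X]
    [TopologicalSpace Xhat] [PathConnectedSpace X] [PathConnectedSpace Xhat]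
    (p : C(Xhat, X)) (hp : IsCoveringMap p) (x : X)
    (N : Subgroup (PiOne x)) [N.Normal]
    (xhat : PiOneOn (p ⁻¹' {x})) (hN : (fibrePush p x xhat).range = N) :
    -- the isomorphism of groupoids over `π₁(X, x)`
    ∃ (T : HatGroupoid (QuotientGroup.mk' N) ⥤ PiOneOn (p ⁻¹' {x}))
      (S : PiOneOn (p ⁻¹' {x}) ⥤ HatGroupoid (QuotientGroup.mk' N)),
      T ⋙ S = 𝟭 _ ∧ S ⋙ T = 𝟭 _ ∧ T.obj ⟨1⟩ = xhat ∧
      (∀ {a b : HatGroupoid (QuotientGroup.mk' N)} (m : a ⟶ b),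
        fibreProj p x (T.map m) = HatGroupoid.proj m) ∧
    -- the isomorphism of abelian groups induced by it
    ∃ Ψ : Totab (HatGroupoid (QuotientGroup.mk' N)) ≃+ RelHomology (p ⁻¹' {x}) 1,
      (∀ {a b : HatGroupoid (QuotientGroup.mk' N)} (m : a ⟶ b)
        (γ : Path (T.obj a).pt (T.obj b).pt),
        PiOneOn.homMk γ = T.map m → Ψ (Totab.of m) = pathClass γ) ∧
    -- the `G`-module structure on the relative homology group
    ∃ _ : DistribMulAction (PiOne x ⧸ N)ᵐᵒᵖ (RelHomology (p ⁻¹' {x}) 1),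
      (∀ (k : (PiOne x ⧸ N)ᵐᵒᵖ) (t : Totab (HatGroupoid (QuotientGroup.mk' N))),
        Ψ (k • t) = k • Ψ t) ∧
      (∀ (h : Xhat ≃ₜ Xhat) (hh : ∀ z, p (h z) = p z) (k : PiOne x ⧸ N),
        h xhat.pt = (T.obj ⟨k⟩).pt → ∀ c : RelHomology (p ⁻¹' {x}) 1,
          MulOpposite.op k • c =
            RelHomology.map (h : C(Xhat, Xhat)) (fun z hz => (hh z).trans hz) 1 c) ∧
    -- the universal derivation
    ∃ δ : PiOne x → RelHomology (p ⁻¹' {x}) 1,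
      (∀ (e : PiOneOn (p ⁻¹' {x})) (γ : Path e.pt xhat.pt),
        δ (fibreProj p x (PiOneOn.homMk γ)) = pathClass γ) ∧
      IsUniversalDerivation.{w} (QuotientGroup.mk' N) δ := by
  refine ⟨hatToFibre hp hN, fibreToHat hN, hatToFibre_comp_fibreToHat hp hN,
    fibreToHat_comp_hatToFibre hp hN, fibrePoint_one hp hN, fibreProj_hatToFibre_map hp hN,
    hatTotabEquiv hp hN, fun m γ hγ => ?_,
    (hatTotabEquiv hp hN).transportDistribMulAction, fun k t => ?_, fun h hh k hk c => ?_,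
    fun u => hatTotabEquiv hp hN (hatDerivation (QuotientGroup.mk' N) u),
    fun e γ => hatTotabEquiv_hatDerivation hp hN γ, ?_⟩
  · rw [hatTotabEquiv_of, ← hγ, homClass_homMk]
  · change _ = hatTotabEquiv hp hN (k • (hatTotabEquiv hp hN).symm (hatTotabEquiv hp hN t))
    rw [AddEquiv.symm_apply_apply]
  · have H := hatTotabEquiv_op_smul hp hN (h : C(Xhat, Xhat)) hh (k := k) (PiOneOn.ext hk)
      ((hatTotabEquiv hp hN).symm c)
    rw [AddEquiv.apply_symm_apply] at H
    exact H
  -- The module structure must be the very action supplied as witness above, so it is put back in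
  -- scope by name.
  · let _ : DistribMulAction (PiOne x ⧸ N)ᵐᵒᵖ (RelHomology (p ⁻¹' {x}) 1) :=
      (hatTotabEquiv hp hN).transportDistribMulAction
    refine (isUniversalDerivation_hatDerivation (QuotientGroup.mk' N)).of_addEquiv
      (hatTotabEquiv hp hN) fun k t => ?_
    change _ = hatTotabEquiv hp hN (k • (hatTotabEquiv hp hN).symm (hatTotabEquiv hp hN t))
    rw [AddEquiv.symm_apply_apply]
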